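/- Let $q\in(1,\infty)$ and let $p$ be its Hölder conjugate, $\frac1p+\frac1q=1$. For $d\in\mathbb N=\{1,2,\ldots\}$ let $\mathbb D_d=\{(a,b)\in[0,1]^d\times[0,1]^d: a\le b\}$ (coordinatewise order) with Lebesgue measure, and $[a,b)=\prod_{j=1}^d[a_j,b_j)$. For $c\in L_q(\mathbb D_d)$ put $(T_dc)(x)=\int_{\mathbb D_d}c(a,b)\,\mathbf 1_{[a,b)}(x)\,\mathrm d(a,b)$, $x\in[0,1]^d$, and let $$F_{d,q}=\{T_dc: c\in L_q(\mathbb D_d)\},\qquad \|f\|=\inf\{\|c\|_{L_q(\mathbb D_d)}: c\in L_q(\mathbb D_d),\ f=T_dc\}.$$ For nodes $\mathcal P=(x_1,\ldots,x_N)$ in $[0,1)^d$ and weights $\mathcal A=(c_1,\ldots,c_N)$ put $$e(\mathcal P,\mathcal A)=\sup_{\|f\|\le1}\Big|\int_{[0,1]^d}f(x)\,\mathrm dx-\sum_{k=1}^Nc_kf(x_k)\Big|,\qquad e_q(0,d)=\sup_{\|f\|\le1}\Big|\int_{[0,1]^d}f(x)\,\mathrm dx\Big|,$$ where $f\in F_{d,q}$,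 let $e_q^+(N,d)$ be the infimum of $e(\mathcal P,\mathcal A)$ over all $N$ nodes in $[0,1)^d$ and all non-negative weights, and let $$N_q^{\mathrm{int},+}(\varepsilon,d)=\min\{N: e_q^+(N,d)\le\varepsilon\,e_q(0,d)\}\qquad(\min\emptyset=\infty).$$ Let $\mathrm{disc}_p^+(N,d)$ be the infimum, over the same nodes and weights, of the $L_p(\mathbb D_d)$-norm of $(a,b)\mapsto\sum_{k=1}^Nc_k\mathbf 1_{[a,b)}(x_k)-\prod_{j=1}^d(b_j-a_j)$, let $L_{p,0}$ be the $L_p(\mathbb D_d)$-norm of $(a,b)\mapsto\prod_{j=1}^d(b_j-a_j)$, and let $N_p^{\mathrm{disc},+}(\varepsilon,d)=\min\{N:\mathrm{disc}_p^+(N,d)\le\varepsilon L_{p,0}\}$ (again $\min\emptyset=\infty$). Then there is a number $C_p>1$, depending only on $p$, such that for all $d\in\mathbb N$ and all $\varepsilon\in[0,\frac12)$ $$N_q^{\mathrm{int},+}(\varepsilon,d)\ge C_p^d\,(1-2\varepsilon),$$ and, with the same number $C_p$, also $N_p^{\mathrm{disc},+}(\varepsilon,d)\ge C_p^d\,(1-2\varepsilon)$.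 In particular, integration in $F_{d,q}$ with non-negative linear rules suffers from the curse of dimensionality: there are $c,\gamma,\varepsilon_0>0$ such that $N_q^{\mathrm{int},+}(\varepsilon,d)\ge c(1+\gamma)^d$ for all $\varepsilon\in(0,\varepsilon_0]$ and all $d\in\mathbb N$. -/

import Mathlib

open MeasureTheory
open scoped ENNReal

noncomputable section

namespace ExtremeDiscrepancy

/-- The parameter domain `𝔻_d = {(a, b) ∈ [0,1]^d × [0,1]^d : a ≤ b}` (coordinatewise order). -/
def boxDomain (d : ℕ) : Set ((Fin d → ℝ) × (Fin d → ℝ)) :=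
  {ab | ab.1 ∈ Set.Icc 0 1 ∧ ab.2 ∈ Set.Icc 0 1 ∧ ab.1 ≤ ab.2}

/-- Lebesgue measure on `𝔻_d`. -/
def boxMeasure (d : ℕ) : Measure ((Fin d → ℝ) × (Fin d → ℝ)) :=
  volume.restrict (boxDomain d)

/-- The half-open box `[a, b) = [a_1, b_1) × ⋯ × [a_d, b_d)`. -/
def box {d : ℕ} (a b : Fin d → ℝ) : Set (Fin d → ℝ) :=
  Set.univ.pi fun j => Set.Ico (a j) (b j)

/-- The indicator function of `[a, b)`. -/
def boxIndicator {d : ℕ} (a b x : Fin d → ℝ) : ℝ :=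
  (box a b).indicator (fun _ => (1 : ℝ)) x

/-- `(T_d c)(x) = ∫_{𝔻_d} c(a, b) 1_{[a,b)}(x) d(a, b)`. This is a function on `[0,1]^d`; it is
extended to `ℝ^d` by the same formula, which gives `0` outside `[0,1]^d`. -/
def boxOperator (d : ℕ) (c : (Fin d → ℝ) × (Fin d → ℝ) → ℝ) (x : Fin d → ℝ) : ℝ :=
  ∫ ab, c ab * boxIndicator ab.1 ab.2 x ∂(boxMeasure d)

/-- The space `F_{d,q} = {T_d c : c ∈ L_q(𝔻_d)}`. -/
def boxSpace (d : ℕ) (q : ℝ) : Set ((Fin d → ℝ) → ℝ) :=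
  {f | ∃ c, MemLp c (ENNReal.ofReal q) (boxMeasure d) ∧ f = boxOperator d c}

/-- The box norm `‖f‖ = inf {‖c‖_{L_q(𝔻_d)} : c ∈ L_q(𝔻_d), f = T_d c}`, finite exactly for
`f` in `F_{d,q}`. -/
def boxNorm (d : ℕ) (q : ℝ) (f : (Fin d → ℝ) → ℝ) : ℝ≥0∞ :=
  ⨅ (c : (Fin d → ℝ) × (Fin d → ℝ) → ℝ)
    (_ : MemLp c (ENNReal.ofReal q) (boxMeasure d)) (_ : f = boxOperator d c),
    eLpNorm c (ENNReal.ofReal q) (boxMeasure d)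

/-- `I(f) = ∫_{[0,1]^d} f(x) dx`. -/
def cubeIntegral {d : ℕ} (f : (Fin d → ℝ) → ℝ) : ℝ :=
  ∫ x in Set.Icc (0 : Fin d → ℝ) 1, f x

/-- The linear rule `Q(f) = ∑_k w_k f(x_k)`. -/
def linearRule {d N : ℕ} (x : Fin N → Fin d → ℝ) (w : Fin N → ℝ)
    (f : (Fin d → ℝ) → ℝ) : ℝ :=
  ∑ k, w k * f (x k)

/-- The worst-case error of a linear rule over the unit ball of `F_{d,q}`. -/
def worstCaseError {d N : ℕ} (q : ℝ) (x : Fin N → Fin d → ℝ) (w : Fin N → ℝ) : ℝ≥0∞ :=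
  ⨆ f ∈ {f | f ∈ boxSpace d q ∧ boxNorm d q f ≤ 1},
    ENNReal.ofReal |cubeIntegral f - linearRule x w f|

/-- The initial error: the worst-case error of the zero rule. -/
def initialError (d : ℕ) (q : ℝ) : ℝ≥0∞ :=
  ⨆ f ∈ {f | f ∈ boxSpace d q ∧ boxNorm d q f ≤ 1}, ENNReal.ofReal |cubeIntegral f|

/-- `N` nodes in `[0,1)^d` with non-negative weights. -/
def nonnegRules (N d : ℕ) : Set ((Fin N → Fin d → ℝ) × (Fin N → ℝ)) :=
  {P | (∀ k j, P.1 k j ∈ Set.Ico (0 : ℝ) 1) ∧ ∀ k, 0 ≤ P.2 k}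

/-- The minimal worst-case error of rules with `N` nodes and non-negative weights. -/
def minErrorNonneg (q : ℝ) (N d : ℕ) : ℝ≥0∞ :=
  ⨅ P ∈ nonnegRules N d, worstCaseError q P.1 P.2

/-- The information complexity of integration in `F_{d,q}` with non-negative linear rules: the
least `N` for which the minimal error is at most `ε` times the initial error (`⊤` if none). -/
def infoComplexityNonneg (q ε : ℝ) (d : ℕ) : ℕ∞ :=
  ⨅ (N : ℕ) (_ : minErrorNonneg q N d ≤ ENNReal.ofReal ε * initialError d q), (N : ℕ∞)

/-- The weighted discrepancy function `∑_k w_k 1_{[a,b)}(x_k) - ∏_j (b_j - a_j)`. -/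
def discrepancyFunction {d N : ℕ} (x : Fin N → Fin d → ℝ) (w : Fin N → ℝ)
    (ab : (Fin d → ℝ) × (Fin d → ℝ)) : ℝ :=
  ∑ k, w k * boxIndicator ab.1 ab.2 (x k) - ∏ j, (ab.2 j - ab.1 j)

/-- The generalized extreme `L_p` discrepancy: the `L_p(𝔻_d)`-norm of the discrepancy function. -/
def extremeDiscrepancy {d N : ℕ} (p : ℝ) (x : Fin N → Fin d → ℝ) (w : Fin N → ℝ) : ℝ≥0∞ :=
  eLpNorm (discrepancyFunction x w) (ENNReal.ofReal p) (boxMeasure d)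

/-- The initial extreme `L_p` discrepancy: the `L_p(𝔻_d)`-norm of the volume function. -/
def initialDiscrepancy (d : ℕ) (p : ℝ) : ℝ≥0∞ :=
  eLpNorm (fun ab : (Fin d → ℝ) × (Fin d → ℝ) => ∏ j, (ab.2 j - ab.1 j))
    (ENNReal.ofReal p) (boxMeasure d)

/-- The minimal extreme `L_p` discrepancy of `N` points with non-negative weights. -/
def minDiscrepancyNonneg (p : ℝ) (N d : ℕ) : ℝ≥0∞ :=
  ⨅ P ∈ nonnegRules N d, extremeDiscrepancy p P.1 P.2

/-- The inverse of the minimal extreme `L_p` discrepancy with non-negative weights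
(`⊤` if there is no admissible `N`). -/
def inverseDiscrepancyNonneg (p ε : ℝ) (d : ℕ) : ℕ∞ :=
  ⨅ (N : ℕ) (_ : minDiscrepancyNonneg p N d ≤ ENNReal.ofReal ε * initialDiscrepancy d p),
    (N : ℕ∞)

/-- The curse of dimensionality: for all small `ε`, the complexity `n ε d` grows at least
exponentially in the dimension `d`, uniformly in `ε`. -/
def CurseOfDimensionality (n : ℝ → ℕ → ℕ∞) : Prop :=
  ∃ c > (0 : ℝ), ∃ γ > (0 : ℝ), ∃ ε₀ > (0 : ℝ), ∀ ε : ℝ, 0 < ε → ε ≤ ε₀ → ∀ d : ℕ, 1 ≤ d →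
    ENNReal.ofReal (c * (1 + γ) ^ d) ≤ ((n ε d : ℕ∞) : ℝ≥0∞)

end ExtremeDiscrepancy

end

/-! Write `V` for the volume of a box and `K` for the integral of `V ^ p` over `𝔻_d`. This integral
factorizes over coordinates, and so does its part over the boxes that contain a fixed point `x`. In
one coordinate, no point lies in intervals carrying more than the fraction `ρ = 1 - missedMass p <
1` of the mass, hence boxes through `x` carry at most `ρ ^ d * K`. By a union bound, boxes avoiding
all `N` nodes carry at least `(1 - N * ρ ^ d) * K` (`le_setIntegral_emptyBoxes`).

On these empty boxes the discrepancy function is `-V`, which bounds the discrepancy below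
(`le_extremeDiscrepancy`). Dually, the Hölder extremal `V ^ (p - 1)`, cut off to the empty boxes,
generates a function that vanishes at all nodes but has a large integral (`le_worstCaseError`). Both
lower bounds are `(1 - N * ρ ^ d) * K ^ (1 / p)`, while the initial quantities are at most `K ^ (1 /
p)`. Error at most `ε` times the initial one thus forces `1 - N * ρ ^ d ≤ ε`, and `C = ρ⁻¹` works.
-/

namespace ExtremeDiscrepancy

/-! ### The one-dimensional mass and the share a single point can capture. -/

/-- The function `(s, t) ↦ (t - s)^p` on the triangle `0 ≤ s ≤ t ≤ 1`, extended by zero. -/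
noncomputable def lengthPow (p : ℝ) : ℝ × ℝ → ℝ :=
  {st : ℝ × ℝ | 0 ≤ st.1 ∧ st.1 ≤ st.2 ∧ st.2 ≤ 1}.indicator fun st => (st.2 - st.1) ^ p

/-- The restriction of `lengthPow p` to the pairs `(s, t)` with `x ∈ [s, t)`. -/
noncomputable def lengthPowAt (p x : ℝ) : ℝ × ℝ → ℝ :=
  {st : ℝ × ℝ | st.1 ≤ x ∧ x < st.2}.indicator (lengthPow p)

lemma lengthPow_nonneg (p : ℝ) (z : ℝ × ℝ) : 0 ≤ lengthPow p z := by
  unfold lengthPow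
  refine Set.indicator_nonneg ?_ z
  rintro ⟨s, t⟩ ⟨-, h, -⟩
  exact Real.rpow_nonneg (sub_nonneg.2 h) p

lemma lengthPow_le_indicator {p : ℝ} (hp : 0 ≤ p) (z : ℝ × ℝ) :
    lengthPow p z ≤ (Set.Icc (0 : ℝ) 1 ×ˢ Set.Icc (0 : ℝ) 1).indicator (fun _ => (1 : ℝ)) z := by
  unfold lengthPow
  refine Set.indicator_le' ?_ ?_ z
  · rintro ⟨s, t⟩ ⟨h1, h2, h3⟩
    dsimp only at h1 h2 h3
    rw [Set.indicator_of_mem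
      (show (s, t) ∈ Set.Icc (0 : ℝ) 1 ×ˢ Set.Icc (0 : ℝ) 1 from
        ⟨⟨h1, h2.trans h3⟩, ⟨h1.trans h2, h3⟩⟩)]
    exact Real.rpow_le_one (sub_nonneg.2 h2) (by dsimp only; linarith) hp
  · exact fun z _ => Set.indicator_nonneg (fun _ _ => zero_le_one) z

lemma measurable_lengthPow (p : ℝ) : Measurable (lengthPow p) := by
  unfold lengthPow
  refine Measurable.indicator (by fun_prop) ?_
  exact (measurableSet_le measurable_const measurable_fst).inter
    ((measurableSet_le measurable_fst measurable_snd).inter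
      (measurableSet_le measurable_snd measurable_const))

lemma integrable_lengthPow {p : ℝ} (hp : 0 ≤ p) : Integrable (lengthPow p) := by
  have h1 : Integrable ((Set.Icc (0 : ℝ) 1 ×ˢ Set.Icc (0 : ℝ) 1).indicator
      (fun _ : ℝ × ℝ => (1 : ℝ))) := by
    refine (integrable_indicator_iff (measurableSet_Icc.prod measurableSet_Icc)).2 ?_
    exact integrableOn_const ((isCompact_Icc.prod isCompact_Icc).measure_lt_top.ne)
  refine h1.mono' (measurable_lengthPow p).aestronglyMeasurable (.of_forall fun z => ?_)
  rw [Real.norm_of_nonneg (lengthPow_nonneg p z)]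
  exact lengthPow_le_indicator hp z

lemma integrable_lengthPowAt {p : ℝ} (hp : 0 ≤ p) (x : ℝ) : Integrable (lengthPowAt p x) :=
  (integrable_lengthPow hp).indicator
    ((measurableSet_le measurable_fst measurable_const).inter
      (measurableSet_lt measurable_const measurable_snd))

lemma integral_lengthPow_le_one {p : ℝ} (hp : 0 ≤ p) : ∫ z, lengthPow p z ≤ 1 := by
  have h := integral_mono_of_nonneg (μ := volume) (.of_forall (lengthPow_nonneg p))
    ((integrable_indicator_iff (measurableSet_Icc.prod measurableSet_Icc)).2
      (integrableOn_const ((isCompact_Icc.prod isCompact_Icc).measure_lt_top.ne)))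
    (.of_forall (lengthPow_le_indicator hp))
  refine h.trans (le_of_eq ?_)
  rw [integral_indicator_const _ (measurableSet_Icc.prod measurableSet_Icc),
    Measure.volume_eq_prod, measureReal_prod_prod]
  simp

/-- A lower bound for the mass of `lengthPow p` that no single point can capture. -/
noncomputable def missedMass (p : ℝ) : ℝ := (1 / 4) ^ p / 64

lemma missedMass_pos (p : ℝ) : 0 < missedMass p := by unfold missedMass; positivity

/-- One half of `[0, 1]` contains only intervals missing `x`. In it there is a square of parameters
with side `1 / 8` on which the length is at least `1 / 4`, whence the value of `missedMass`. -/
lemma integral_lengthPowAt_add_le {p : ℝ} (hp : 0 ≤ p) (x : ℝ) :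
    (∫ z, lengthPowAt p x z) + missedMass p ≤ ∫ z, lengthPow p z := by
  -- The half `[u, u + 1 / 2]` is chosen on the side away from `x`; touching at its right end is
  -- harmless because the intervals `[s, t)` are half-open.
  obtain ⟨u, hu0, hu1, hux⟩ : ∃ u : ℝ, 0 ≤ u ∧ u ≤ 1 / 2 ∧ (x < u ∨ u + 1 / 2 ≤ x) := by
    rcases lt_or_ge x (1 / 2) with h | h
    · exact ⟨1 / 2, by norm_num, le_rfl, .inl h⟩
    · exact ⟨0, le_rfl, by norm_num, .inr (by linarith)⟩
  set R : Set (ℝ × ℝ) := Set.Icc u (u + 1 / 8) ×ˢ Set.Icc (u + 3 / 8) (u + 1 / 2)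
  have hR : MeasurableSet R := measurableSet_Icc.prod measurableSet_Icc
  have hRi : Integrable (R.indicator fun _ => ((1 : ℝ) / 4) ^ p) :=
    (integrable_indicator_iff hR).2
      (integrableOn_const ((isCompact_Icc.prod isCompact_Icc).measure_lt_top.ne))
  have hRm : ∫ z, R.indicator (fun _ => ((1 : ℝ) / 4) ^ p) z = missedMass p := by
    rw [integral_indicator_const _ hR, Measure.volume_eq_prod, measureReal_prod_prod]
    simp only [Real.volume_real_Icc, missedMass, smul_eq_mul]
    rw [max_eq_left (by linarith), max_eq_left (by linarith)]
    ring
  rw [← hRm, ← integral_add (integrable_lengthPowAt hp x) hRi]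
  refine integral_mono ((integrable_lengthPowAt hp x).add hRi) (integrable_lengthPow hp) ?_
  rintro ⟨s, t⟩
  by_cases hst : (s, t) ∈ R
  · have hst' := hst
    obtain ⟨⟨h1, h2⟩, h3, h4⟩ := hst'
    dsimp only at h1 h2 h3 h4
    have hx : (s, t) ∉ {st : ℝ × ℝ | st.1 ≤ x ∧ x < st.2} := by
      rintro ⟨h5, h6⟩
      dsimp only at h5 h6
      rcases hux with h | h <;> linarith
    have hD : (s, t) ∈ {st : ℝ × ℝ | 0 ≤ st.1 ∧ st.1 ≤ st.2 ∧ st.2 ≤ 1} :=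
      ⟨by dsimp only; linarith, by dsimp only; linarith, by dsimp only; linarith⟩
    simp only [lengthPowAt, Set.indicator_of_notMem hx, Set.indicator_of_mem hst, zero_add,
      lengthPow, Set.indicator_of_mem hD]
    exact Real.rpow_le_rpow (by norm_num) (by linarith) hp
  · simp only [Set.indicator_of_notMem hst, add_zero]
    exact Set.indicator_le_self' (fun _ _ => lengthPow_nonneg p _) _

lemma integral_lengthPowAt_nonneg (p x : ℝ) : 0 ≤ ∫ z, lengthPowAt p x z :=
  integral_nonneg fun z => Set.indicator_nonneg (fun _ _ => lengthPow_nonneg p _) z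

lemma missedMass_lt_one {p : ℝ} (hp : 0 ≤ p) : missedMass p < 1 := by
  have : ((1 : ℝ) / 4) ^ p ≤ 1 := Real.rpow_le_one (by norm_num) (by norm_num) hp
  unfold missedMass
  linarith

lemma integral_lengthPow_pos {p : ℝ} (hp : 0 ≤ p) : 0 < ∫ z, lengthPow p z := by
  linarith [integral_lengthPowAt_add_le hp 0, integral_lengthPowAt_nonneg p 0, missedMass_pos p]

/-- The additive gap becomes a multiplicative one because the total mass is at most `1`; only the
factor form survives taking products over coordinates. -/
lemma integral_lengthPowAt_le {p : ℝ} (hp : 0 ≤ p) (x : ℝ) :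
    ∫ z, lengthPowAt p x z ≤ (1 - missedMass p) * ∫ z, lengthPow p z := by
  nlinarith [integral_lengthPowAt_add_le hp x, integral_lengthPow_le_one hp, missedMass_pos p]

/-! ### The mass of `V ^ p` on `𝔻_d` and on the empty boxes. -/

/-- The volume `∏ j, (b j - a j)` of the box `[a, b)`. -/
def boxVolume {d : ℕ} (ab : (Fin d → ℝ) × (Fin d → ℝ)) : ℝ := ∏ j, (ab.2 j - ab.1 j)

/-- The parameters of the boxes which contain none of the nodes. -/
def emptyBoxes {d N : ℕ} (x : Fin N → Fin d → ℝ) : Set ((Fin d → ℝ) × (Fin d → ℝ)) :=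
  {ab | ∀ k, x k ∉ box ab.1 ab.2}

variable {d N : ℕ}

lemma measurableSet_boxDomain (d : ℕ) : MeasurableSet (boxDomain d) := by
  have h : IsClosed (boxDomain d) := by
    refine (isClosed_Icc.preimage continuous_fst).inter
      ((isClosed_Icc.preimage continuous_snd).inter ?_)
    exact isClosed_le continuous_fst continuous_snd
  exact h.measurableSet

instance : IsFiniteMeasure (boxMeasure d) := by
  refine ⟨?_⟩
  rw [boxMeasure, Measure.restrict_apply_univ]
  refine lt_of_le_of_lt (measure_mono (t := Set.Icc 0 1 ×ˢ Set.Icc 0 1) ?_)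
    (isCompact_Icc.prod isCompact_Icc).measure_lt_top
  exact fun ab h => ⟨h.1, h.2.1⟩

lemma ae_mem_boxDomain : ∀ᵐ ab ∂boxMeasure d, ab ∈ boxDomain d :=
  ae_restrict_mem (measurableSet_boxDomain d)

lemma measurable_boxVolume : Measurable (boxVolume (d := d)) := by
  unfold boxVolume
  fun_prop

lemma boxVolume_nonneg {ab : (Fin d → ℝ) × (Fin d → ℝ)} (h : ab ∈ boxDomain d) :
    0 ≤ boxVolume ab :=
  Finset.prod_nonneg fun j _ => sub_nonneg.2 (h.2.2 j)

lemma boxVolume_le_one {ab : (Fin d → ℝ) × (Fin d → ℝ)} (h : ab ∈ boxDomain d) :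
    boxVolume ab ≤ 1 := by
  refine Finset.prod_le_one (fun j _ => sub_nonneg.2 (h.2.2 j)) fun j _ => ?_
  have h1 := h.1.1 j
  have h2 := h.2.1.2 j
  simp only [Pi.zero_apply, Pi.one_apply] at h1 h2
  linarith

lemma measurableSet_mem_box (x : Fin d → ℝ) :
    MeasurableSet {ab : (Fin d → ℝ) × (Fin d → ℝ) | x ∈ box ab.1 ab.2} := by
  have : {ab : (Fin d → ℝ) × (Fin d → ℝ) | x ∈ box ab.1 ab.2} =
      ⋂ j, {ab | ab.1 j ≤ x j ∧ x j < ab.2 j} := by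
    ext ab
    simp [box]
  rw [this]
  refine MeasurableSet.iInter fun j => ?_
  exact (measurableSet_le ((measurable_pi_apply j).comp measurable_fst) measurable_const).inter
    (measurableSet_lt measurable_const ((measurable_pi_apply j).comp measurable_snd))

lemma measurableSet_emptyBoxes (x : Fin N → Fin d → ℝ) : MeasurableSet (emptyBoxes x) := by
  have : emptyBoxes x = ⋂ k, {ab | x k ∈ box ab.1 ab.2}ᶜ := by
    ext ab
    simp [emptyBoxes]
  rw [this]
  exact MeasurableSet.iInter fun k => (measurableSet_mem_box (x k)).compl

lemma integrable_boxVolume_rpow {p : ℝ} (hp : 0 ≤ p) :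
    Integrable (fun ab => boxVolume ab ^ p) (boxMeasure d) := by
  refine Integrable.of_bound (measurable_boxVolume.pow_const p).aestronglyMeasurable 1 ?_
  filter_upwards [ae_mem_boxDomain] with ab h
  rw [Real.norm_of_nonneg (Real.rpow_nonneg (boxVolume_nonneg h) p)]
  exact Real.rpow_le_one (boxVolume_nonneg h) (boxVolume_le_one h) hp

/-- Regrouping a pair of vectors as a vector of pairs preserves Lebesgue measure, which reduces this
to Fubini. -/
lemma integral_prod_coordinates (f : Fin d → ℝ × ℝ → ℝ) :
    ∫ ab : (Fin d → ℝ) × (Fin d → ℝ), ∏ j, f j (ab.1 j, ab.2 j) = ∏ j, ∫ z, f j z := by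
  rw [← integral_fintype_prod_volume_eq_prod,
    ← (volume_measurePreserving_arrowProdEquivProdArrow ℝ ℝ (Fin d)).integral_comp']
  rfl

lemma prod_lengthPow (p : ℝ) (ab : (Fin d → ℝ) × (Fin d → ℝ)) :
    ∏ j, lengthPow p (ab.1 j, ab.2 j) =
      (boxDomain d).indicator (fun ab => boxVolume ab ^ p) ab := by
  by_cases h : ab ∈ boxDomain d
  · rw [Set.indicator_of_mem h, boxVolume,
      ← Real.finsetProd_rpow _ _ (fun j _ => sub_nonneg.2 (h.2.2 j))]
    refine Finset.prod_congr rfl fun j _ => ?_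
    exact Set.indicator_of_mem (show (ab.1 j, ab.2 j) ∈
      {st : ℝ × ℝ | 0 ≤ st.1 ∧ st.1 ≤ st.2 ∧ st.2 ≤ 1} from
      ⟨h.1.1 j, h.2.2 j, h.2.1.2 j⟩) _
  · rw [Set.indicator_of_notMem h]
    have : ∃ j, ¬ (0 ≤ ab.1 j ∧ ab.1 j ≤ ab.2 j ∧ ab.2 j ≤ 1) := by
      by_contra! hc
      refine h ⟨⟨fun j => (hc j).1, fun j => (hc j).2.1.trans (hc j).2.2⟩,
        ⟨fun j => (hc j).1.trans (hc j).2.1, fun j => (hc j).2.2⟩, fun j => (hc j).2.1⟩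
    obtain ⟨j, hj⟩ := this
    exact Finset.prod_eq_zero (Finset.mem_univ j) (Set.indicator_of_notMem (show (ab.1 j, ab.2 j) ∉
      {st : ℝ × ℝ | 0 ≤ st.1 ∧ st.1 ≤ st.2 ∧ st.2 ≤ 1} from hj) _)

lemma prod_lengthPowAt (p : ℝ) (x : Fin d → ℝ) (ab : (Fin d → ℝ) × (Fin d → ℝ)) :
    ∏ j, lengthPowAt p (x j) (ab.1 j, ab.2 j) =
      {ab : (Fin d → ℝ) × (Fin d → ℝ) | x ∈ box ab.1 ab.2}.indicator
        (fun ab => ∏ j, lengthPow p (ab.1 j, ab.2 j)) ab := by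
  by_cases h : x ∈ box ab.1 ab.2
  · rw [Set.indicator_of_mem (show ab ∈ {ab | x ∈ box ab.1 ab.2} from h)]
    refine Finset.prod_congr rfl fun j _ => ?_
    have hj := h j (Set.mem_univ j)
    exact Set.indicator_of_mem (show (ab.1 j, ab.2 j) ∈
      {st : ℝ × ℝ | st.1 ≤ x j ∧ x j < st.2} from hj) _
  · rw [Set.indicator_of_notMem (show ab ∉ {ab | x ∈ box ab.1 ab.2} from h)]
    have : ∃ j, ¬ (ab.1 j ≤ x j ∧ x j < ab.2 j) := by
      by_contra! hc
      exact h fun j _ => hc j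
    obtain ⟨j, hj⟩ := this
    exact Finset.prod_eq_zero (Finset.mem_univ j) (Set.indicator_of_notMem (show (ab.1 j, ab.2 j) ∉
      {st : ℝ × ℝ | st.1 ≤ x j ∧ x j < st.2} from hj) _)

lemma integral_boxVolume_rpow (p : ℝ) :
    ∫ ab, boxVolume ab ^ p ∂boxMeasure d = (∫ z, lengthPow p z) ^ d := by
  rw [boxMeasure, ← integral_indicator (measurableSet_boxDomain d)]
  simp_rw [← prod_lengthPow]
  rw [integral_prod_coordinates]
  simp

lemma setIntegral_boxVolume_rpow_mem_box (p : ℝ) (x : Fin d → ℝ) :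
    ∫ ab in {ab | x ∈ box ab.1 ab.2}, boxVolume ab ^ p ∂boxMeasure d =
      ∏ j, ∫ z, lengthPowAt p (x j) z := by
  rw [← integral_prod_coordinates, ← integral_indicator (measurableSet_mem_box x), boxMeasure,
    ← integral_indicator (measurableSet_boxDomain d)]
  refine integral_congr_ae (.of_forall fun ab => ?_)
  simp only [prod_lengthPowAt, prod_lengthPow, Set.indicator_indicator]
  rw [Set.inter_comm]

lemma integral_boxVolume_rpow_pos {p : ℝ} (hp : 0 ≤ p) :
    0 < ∫ ab, boxVolume ab ^ p ∂boxMeasure d := by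
  rw [integral_boxVolume_rpow]
  exact pow_pos (integral_lengthPow_pos hp) d

lemma setIntegral_boxVolume_rpow_mem_box_le {p : ℝ} (hp : 0 ≤ p) (x : Fin d → ℝ) :
    ∫ ab in {ab | x ∈ box ab.1 ab.2}, boxVolume ab ^ p ∂boxMeasure d ≤
      (1 - missedMass p) ^ d * ∫ ab, boxVolume ab ^ p ∂boxMeasure d := by
  rw [setIntegral_boxVolume_rpow_mem_box, integral_boxVolume_rpow, ← mul_pow]
  refine (Finset.prod_le_prod (fun j _ => integral_lengthPowAt_nonneg p (x j))
    fun j _ => integral_lengthPowAt_le hp (x j)).trans_eq ?_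
  simp

/-- Boxes without nodes carry all but an exponentially small part, per node, of the mass. -/
lemma le_setIntegral_emptyBoxes {p : ℝ} (hp : 0 ≤ p) (x : Fin N → Fin d → ℝ) :
    (1 - N * (1 - missedMass p) ^ d) * ∫ ab, boxVolume ab ^ p ∂boxMeasure d ≤
      ∫ ab in emptyBoxes x, boxVolume ab ^ p ∂boxMeasure d := by
  have hi := integrable_boxVolume_rpow (d := d) hp
  have hI : ∀ k, Integrable ({ab : (Fin d → ℝ) × (Fin d → ℝ) | x k ∈ box ab.1 ab.2}.indicator
      fun ab => boxVolume ab ^ p) (boxMeasure d) := fun k =>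
    hi.indicator (measurableSet_mem_box (x k))
  -- Union bound: each box is empty or contains some `x k`, so these indicators cover almost all of
  -- `𝔻_d`.
  have hmono : ∫ ab, boxVolume ab ^ p ∂boxMeasure d ≤
      ∫ ab, ((emptyBoxes x).indicator (fun ab => boxVolume ab ^ p) ab +
        ∑ k, {ab : (Fin d → ℝ) × (Fin d → ℝ) | x k ∈ box ab.1 ab.2}.indicator
          (fun ab => boxVolume ab ^ p) ab) ∂boxMeasure d := by
    refine integral_mono_ae hi ((hi.indicator (measurableSet_emptyBoxes x)).add
      (integrable_finsetSum _ fun k _ => hI k)) ?_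
    filter_upwards [ae_mem_boxDomain] with ab hab
    have h0 : 0 ≤ boxVolume ab ^ p := Real.rpow_nonneg (boxVolume_nonneg hab) p
    have hk : ∀ k, 0 ≤ {ab : (Fin d → ℝ) × (Fin d → ℝ) | x k ∈ box ab.1 ab.2}.indicator
        (fun ab => boxVolume ab ^ p) ab := fun k => Set.indicator_apply_nonneg fun _ => h0
    by_cases h : ab ∈ emptyBoxes x
    · rw [Set.indicator_of_mem h]
      linarith [Finset.sum_nonneg fun k (_ : k ∈ Finset.univ) => hk k]
    · rw [Set.indicator_of_notMem h, zero_add]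
      obtain ⟨k, hxk⟩ : ∃ k, x k ∈ box ab.1 ab.2 := by
        by_contra! hc
        exact h hc
      refine le_trans (le_of_eq ?_)
        (Finset.single_le_sum (fun k _ => hk k) (Finset.mem_univ k))
      rw [Set.indicator_of_mem (show ab ∈ {ab | x k ∈ box ab.1 ab.2} from hxk)]
  rw [integral_add (hi.indicator (measurableSet_emptyBoxes x))
    (integrable_finsetSum _ fun k _ => hI k), integral_finsetSum _ fun k _ => hI k,
    integral_indicator (measurableSet_emptyBoxes x)] at hmono
  have hsum : ∑ k, ∫ ab, {ab : (Fin d → ℝ) × (Fin d → ℝ) | x k ∈ box ab.1 ab.2}.indicator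
      (fun ab => boxVolume ab ^ p) ab ∂boxMeasure d ≤
      ∑ _k : Fin N, (1 - missedMass p) ^ d * ∫ ab, boxVolume ab ^ p ∂boxMeasure d := by
    refine Finset.sum_le_sum fun k _ => ?_
    rw [integral_indicator (measurableSet_mem_box (x k))]
    exact setIntegral_boxVolume_rpow_mem_box_le hp (x k)
  rw [Finset.sum_const, Finset.card_univ, Fintype.card_fin, nsmul_eq_mul] at hsum
  linarith

/-! ### Lower bound for the extreme discrepancy. -/

lemma memLp_boxVolume (r : ℝ≥0∞) : MemLp (boxVolume (d := d)) r (boxMeasure d) := by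
  refine MemLp.of_bound measurable_boxVolume.aestronglyMeasurable 1 ?_
  filter_upwards [ae_mem_boxDomain] with ab h
  rw [Real.norm_of_nonneg (boxVolume_nonneg h)]
  exact boxVolume_le_one h

lemma initialDiscrepancy_eq {p : ℝ} (hp : 1 < p) :
    initialDiscrepancy d p =
      ENNReal.ofReal ((∫ ab, boxVolume ab ^ p ∂boxMeasure d) ^ (1 / p)) := by
  change eLpNorm (boxVolume (d := d)) _ _ = _
  rw [(memLp_boxVolume _).eLpNorm_eq_integral_rpow_norm (by simpa using by linarith) (by simp),
    ENNReal.toReal_ofReal (by linarith), one_div]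
  congr 2
  refine integral_congr_ae ?_
  filter_upwards [ae_mem_boxDomain] with ab h
  rw [Real.norm_of_nonneg (boxVolume_nonneg h)]

lemma discrepancyFunction_of_mem_emptyBoxes {x : Fin N → Fin d → ℝ} (w : Fin N → ℝ)
    {ab : (Fin d → ℝ) × (Fin d → ℝ)} (h : ab ∈ emptyBoxes x) :
    discrepancyFunction x w ab = -boxVolume ab := by
  have : ∀ k, boxIndicator ab.1 ab.2 (x k) = 0 := fun k => Set.indicator_of_notMem (h k) _
  simp [discrepancyFunction, this, boxVolume]

lemma le_extremeDiscrepancy {p : ℝ} (hp : 1 < p) (x : Fin N → Fin d → ℝ) (w : Fin N → ℝ) :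
    ENNReal.ofReal (1 - N * (1 - missedMass p) ^ d) *
        ENNReal.ofReal ((∫ ab, boxVolume ab ^ p ∂boxMeasure d) ^ (1 / p)) ≤
      extremeDiscrepancy p x w := by
  set K := ∫ ab, boxVolume ab ^ p ∂boxMeasure d with hK
  set θ := 1 - N * (1 - missedMass p) ^ d with hθ
  have hp0 : 0 < p := by linarith
  have hK0 : 0 < K := integral_boxVolume_rpow_pos hp0.le
  rcases le_or_gt θ 0 with hneg | hpos
  · simp [ENNReal.ofReal_of_nonpos hneg]
  have hθ1 : θ ≤ 1 := by
    have : 0 ≤ 1 - missedMass p := by linarith [missedMass_lt_one hp0.le]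
    have : 0 ≤ N * (1 - missedMass p) ^ d := by positivity
    linarith
  have h1 : eLpNorm ((emptyBoxes x).indicator boxVolume) (ENNReal.ofReal p) (boxMeasure d) ≤
      extremeDiscrepancy p x w := by
    refine eLpNorm_mono fun ab => ?_
    by_cases h : ab ∈ emptyBoxes x
    · rw [Set.indicator_of_mem h, discrepancyFunction_of_mem_emptyBoxes w h, norm_neg]
    · rw [Set.indicator_of_notMem h, norm_zero]
      exact norm_nonneg _
  refine le_trans ?_ h1
  rw [((memLp_boxVolume _).indicator (measurableSet_emptyBoxes x)).eLpNorm_eq_integral_rpow_norm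
    (by simpa using hp0) (by simp), ENNReal.toReal_ofReal hp0.le, ← one_div,
    ← ENNReal.ofReal_mul hpos.le]
  have h2 : ∫ ab, ‖(emptyBoxes x).indicator boxVolume ab‖ ^ p ∂boxMeasure d =
      ∫ ab in emptyBoxes x, boxVolume ab ^ p ∂boxMeasure d := by
    rw [← integral_indicator (measurableSet_emptyBoxes x)]
    refine integral_congr_ae ?_
    filter_upwards [ae_mem_boxDomain] with ab hab
    by_cases h : ab ∈ emptyBoxes x
    · rw [Set.indicator_of_mem h, Set.indicator_of_mem h,
        Real.norm_of_nonneg (boxVolume_nonneg hab)]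
    · rw [Set.indicator_of_notMem h, Set.indicator_of_notMem h, norm_zero,
        Real.zero_rpow hp0.ne']
  rw [h2]
  refine ENNReal.ofReal_le_ofReal ?_
  -- The natural factor `θ ^ (1 / p)` is weakened to `θ`, valid for `0 < θ ≤ 1` and `p > 1`; this
  -- matches the factor obtained for integration.
  calc θ * K ^ (1 / p) ≤ θ ^ (1 / p) * K ^ (1 / p) := by
        gcongr
        refine (Real.rpow_one θ).symm.le.trans ?_
        exact Real.rpow_le_rpow_of_exponent_ge hpos hθ1 (by rw [div_le_one hp0]; exact hp.le)
    _ = (θ * K) ^ (1 / p) := (Real.mul_rpow hpos.le hK0.le).symm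
    _ ≤ _ := Real.rpow_le_rpow (by positivity) (le_setIntegral_emptyBoxes hp0.le x)
        (by positivity)

/-! ### The integration functional and its initial error. -/

lemma setIntegral_boxIndicator {ab : (Fin d → ℝ) × (Fin d → ℝ)} (h : ab ∈ boxDomain d) :
    ∫ x in Set.Icc (0 : Fin d → ℝ) 1, boxIndicator ab.1 ab.2 x = boxVolume ab := by
  have hm : MeasurableSet (box ab.1 ab.2) := MeasurableSet.univ_pi fun j => measurableSet_Ico
  have hsub : box ab.1 ab.2 ⊆ Set.Icc 0 1 := fun x hx =>
    ⟨fun j => (h.1.1 j).trans (hx j (Set.mem_univ j)).1,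
      fun j => (hx j (Set.mem_univ j)).2.le.trans (h.2.1.2 j)⟩
  have : ∫ x in Set.Icc (0 : Fin d → ℝ) 1, boxIndicator ab.1 ab.2 x =
      ∫ x in Set.Icc (0 : Fin d → ℝ) 1, (box ab.1 ab.2).indicator (fun _ => (1 : ℝ)) x := rfl
  rw [this, integral_indicator hm, Measure.restrict_restrict hm, Set.inter_eq_left.2 hsub,
    integral_const, smul_eq_mul, mul_one, measureReal_restrict_apply_univ]
  exact Real.volume_pi_Ico_toReal h.2.2

/-- By Fubini, integration on `F_{d,q}` is pairing the density with `V`; this is the duality between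
integration and discrepancy. -/
lemma cubeIntegral_boxOperator {c : (Fin d → ℝ) × (Fin d → ℝ) → ℝ}
    (hc : Integrable c (boxMeasure d)) :
    cubeIntegral (boxOperator d c) = ∫ ab, c ab * boxVolume ab ∂boxMeasure d := by
  have hS : MeasurableSet {z : (Fin d → ℝ) × ((Fin d → ℝ) × (Fin d → ℝ)) |
      z.1 ∈ box z.2.1 z.2.2} := by
    have : {z : (Fin d → ℝ) × ((Fin d → ℝ) × (Fin d → ℝ)) | z.1 ∈ box z.2.1 z.2.2} =
        ⋂ j, {z | z.2.1 j ≤ z.1 j ∧ z.1 j < z.2.2 j} := by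
      ext z
      simp [box]
    rw [this]
    refine MeasurableSet.iInter fun j => ?_
    have h1 : Measurable fun z : (Fin d → ℝ) × ((Fin d → ℝ) × (Fin d → ℝ)) => z.1 j := by
      fun_prop
    have h2 : Measurable fun z : (Fin d → ℝ) × ((Fin d → ℝ) × (Fin d → ℝ)) => z.2.1 j := by
      fun_prop
    have h3 : Measurable fun z : (Fin d → ℝ) × ((Fin d → ℝ) × (Fin d → ℝ)) => z.2.2 j := by
      fun_prop
    exact (measurableSet_le h2 h1).inter (measurableSet_lt h1 h3)
  have hfin : IsFiniteMeasure (volume.restrict (Set.Icc (0 : Fin d → ℝ) 1)) :=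
    ⟨by rw [Measure.restrict_apply_univ]; exact isCompact_Icc.measure_lt_top⟩
  have hint : Integrable (Function.uncurry fun (x : Fin d → ℝ)
      (ab : (Fin d → ℝ) × (Fin d → ℝ)) => c ab * boxIndicator ab.1 ab.2 x)
      ((volume.restrict (Set.Icc (0 : Fin d → ℝ) 1)).prod (boxMeasure d)) := by
    refine ((hc.comp_snd (volume.restrict (Set.Icc (0 : Fin d → ℝ) 1))).indicator hS).congr
      (.of_forall fun z => ?_)
    by_cases hz : z.1 ∈ box z.2.1 z.2.2
    · rw [Set.indicator_of_mem (show z ∈ {z | z.1 ∈ box z.2.1 z.2.2} from hz)]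
      simp [Function.uncurry, boxIndicator, hz]
    · rw [Set.indicator_of_notMem (show z ∉ {z | z.1 ∈ box z.2.1 z.2.2} from hz)]
      simp [Function.uncurry, boxIndicator, hz]
  unfold cubeIntegral boxOperator
  rw [integral_integral_swap hint]
  refine integral_congr_ae ?_
  filter_upwards [ae_mem_boxDomain] with ab hab
  rw [integral_const_mul, setIntegral_boxIndicator hab]

lemma enorm_integral_mul_boxVolume_le {r s : ℝ≥0∞} (hrs : ENNReal.HolderConjugate r s)
    {c : (Fin d → ℝ) × (Fin d → ℝ) → ℝ} (hc : AEStronglyMeasurable c (boxMeasure d)) :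
    ‖∫ ab, c ab * boxVolume ab ∂boxMeasure d‖ₑ ≤
      eLpNorm c r (boxMeasure d) * eLpNorm boxVolume s (boxMeasure d) := by
  refine (enorm_integral_le_lintegral_enorm _).trans ?_
  rw [← eLpNorm_one_eq_lintegral_enorm]
  exact eLpNorm_smul_le_mul_eLpNorm (f := boxVolume) (φ := c) (p := r) (q := s)
    measurable_boxVolume.aestronglyMeasurable hc

lemma initialError_le {p q : ℝ} (hpq : p.HolderConjugate q) :
    initialError d q ≤
      ENNReal.ofReal ((∫ ab, boxVolume ab ^ p ∂boxMeasure d) ^ (1 / p)) := by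
  have hK0 := integral_boxVolume_rpow_pos (d := d) hpq.nonneg
  have hE : ENNReal.ofReal ((∫ ab, boxVolume ab ^ p ∂boxMeasure d) ^ (1 / p)) ≠ 0 := by
    simpa using Real.rpow_pos_of_pos hK0 _
  refine iSup₂_le fun f hf => ?_
  -- Hölder applies to each representing density `c`. Dividing first lets the bound pass to the
  -- infimum `boxNorm`, with no need for it to be attained.
  have hle : ENNReal.ofReal |cubeIntegral f| /
      ENNReal.ofReal ((∫ ab, boxVolume ab ^ p ∂boxMeasure d) ^ (1 / p)) ≤ boxNorm d q f := by
    refine le_iInf fun c => le_iInf fun hc => le_iInf fun hfc => ?_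
    refine ENNReal.div_le_of_le_mul ?_
    subst hfc
    have hq1 : (1 : ℝ≥0∞) ≤ ENNReal.ofReal q := by
      rw [← ENNReal.ofReal_one]
      exact ENNReal.ofReal_le_ofReal hpq.symm.lt.le
    rw [cubeIntegral_boxOperator (hc.integrable hq1), ← initialDiscrepancy_eq hpq.lt,
      ← Real.enorm_eq_ofReal_abs]
    exact enorm_integral_mul_boxVolume_le hpq.symm.ennrealOfReal hc.1
  simpa only [one_mul] using
    (ENNReal.div_le_iff hE ENNReal.ofReal_ne_top).1 (hle.trans hf.2)

/-! ### The fooling function and the lower bound for the worst-case error. -/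

/-- The fooling density: the extremal density of Hölder's inequality for the volume function,
restricted to the boxes without nodes and normalized in `L_q`. -/
noncomputable def foolingDensity (p q : ℝ) (x : Fin N → Fin d → ℝ) :
    (Fin d → ℝ) × (Fin d → ℝ) → ℝ :=
  (emptyBoxes x).indicator fun ab =>
    (∫ ab, boxVolume ab ^ p ∂boxMeasure d) ^ (-(1 / q)) * boxVolume ab ^ (p - 1)

lemma memLp_foolingDensity {p : ℝ} (hp : 1 < p) (q : ℝ) (r : ℝ≥0∞) (x : Fin N → Fin d → ℝ) :
    MemLp (foolingDensity p q x) r (boxMeasure d) := by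
  refine MemLp.indicator (measurableSet_emptyBoxes x) (MemLp.const_mul ?_ _)
  refine MemLp.of_bound (measurable_boxVolume.pow_const _).aestronglyMeasurable 1 ?_
  filter_upwards [ae_mem_boxDomain] with ab h
  rw [Real.norm_of_nonneg (Real.rpow_nonneg (boxVolume_nonneg h) _)]
  exact Real.rpow_le_one (boxVolume_nonneg h) (boxVolume_le_one h) (by linarith)

lemma eLpNorm_foolingDensity_le {p q : ℝ} (hpq : p.HolderConjugate q)
    (x : Fin N → Fin d → ℝ) :
    eLpNorm (foolingDensity p q x) (ENNReal.ofReal q) (boxMeasure d) ≤ 1 := by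
  have hK0 := integral_boxVolume_rpow_pos (d := d) hpq.nonneg
  have hq0 := hpq.symm.pos
  set K := ∫ ab, boxVolume ab ^ p ∂boxMeasure d with hK
  have hm := memLp_foolingDensity hpq.lt q (ENNReal.ofReal q) x
  rw [hm.eLpNorm_eq_integral_rpow_norm (by simpa using hq0) (by simp),
    ENNReal.toReal_ofReal hq0.le]
  refine ENNReal.ofReal_le_one.2 (Real.rpow_le_one (integral_nonneg fun _ => by positivity) ?_
    (by positivity))
  have hle : ∫ ab, ‖foolingDensity p q x ab‖ ^ q ∂boxMeasure d ≤
      ∫ ab, K⁻¹ * boxVolume ab ^ p ∂boxMeasure d := by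
    refine integral_mono_of_nonneg (.of_forall fun _ => by positivity)
      ((integrable_boxVolume_rpow hpq.nonneg).const_mul _) ?_
    filter_upwards [ae_mem_boxDomain] with ab hab
    have hV := boxVolume_nonneg hab
    by_cases h : ab ∈ emptyBoxes x
    · rw [foolingDensity, Set.indicator_of_mem h, Real.norm_of_nonneg (by positivity),
        Real.mul_rpow (by positivity) (by positivity), ← Real.rpow_mul hK0.le,
        ← Real.rpow_mul hV, hpq.sub_one_mul_conj, ← Real.rpow_neg_one]
      -- Since `(p - 1) * q = p`, the `q`-th power of the density is `K⁻¹ * V ^ p` on the empty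
      -- boxes; only `K ^ (-(1 / q) * q) = K ^ (-1)` remains.
      refine le_of_eq ?_
      congr 2
      field_simp
    · rw [foolingDensity, Set.indicator_of_notMem h, norm_zero, Real.zero_rpow hq0.ne']
      positivity
  refine hle.trans (le_of_eq ?_)
  rw [integral_const_mul, ← hK, inv_mul_cancel₀ hK0.ne']

lemma le_worstCaseError {p q : ℝ} (hpq : p.HolderConjugate q) (x : Fin N → Fin d → ℝ)
    (w : Fin N → ℝ) :
    ENNReal.ofReal (1 - N * (1 - missedMass p) ^ d) *
        ENNReal.ofReal ((∫ ab, boxVolume ab ^ p ∂boxMeasure d) ^ (1 / p)) ≤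
      worstCaseError q x w := by
  have hK0 := integral_boxVolume_rpow_pos (d := d) hpq.nonneg
  set K := ∫ ab, boxVolume ab ^ p ∂boxMeasure d with hK
  set c := foolingDensity p q x with hc
  have hmem : MemLp c (ENNReal.ofReal q) (boxMeasure d) := memLp_foolingDensity hpq.lt q _ x
  have hnorm : boxNorm d q (boxOperator d c) ≤ 1 := by
    unfold boxNorm
    exact (iInf₂_le c hmem).trans ((iInf_le _ rfl).trans (eLpNorm_foolingDensity_le hpq x))
  have hball : boxOperator d c ∈ {f | f ∈ boxSpace d q ∧ boxNorm d q f ≤ 1} :=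
    ⟨⟨c, hmem, rfl⟩, hnorm⟩
  refine le_trans ?_ (le_iSup₂ (f := fun f _ =>
    ENNReal.ofReal |cubeIntegral f - linearRule x w f|) _ hball)
  -- At a node the integrand vanishes identically: the density lives on boxes that do not contain
  -- it.
  have hrule : linearRule x w (boxOperator d c) = 0 := by
    refine Finset.sum_eq_zero fun k _ => ?_
    have : ∀ ab : (Fin d → ℝ) × (Fin d → ℝ), c ab * boxIndicator ab.1 ab.2 (x k) = 0 := by
      intro ab
      by_cases h : ab ∈ emptyBoxes x
      · rw [boxIndicator, Set.indicator_of_notMem (h k), mul_zero]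
      · rw [hc, foolingDensity, Set.indicator_of_notMem h, zero_mul]
    simp [boxOperator, this]
  have hint : cubeIntegral (boxOperator d c) =
      K ^ (-(1 / q)) * ∫ ab in emptyBoxes x, boxVolume ab ^ p ∂boxMeasure d := by
    rw [cubeIntegral_boxOperator ((memLp_foolingDensity hpq.lt q 1 x).integrable le_rfl),
      ← integral_const_mul, ← integral_indicator (measurableSet_emptyBoxes x)]
    refine integral_congr_ae ?_
    filter_upwards [ae_mem_boxDomain] with ab hab
    by_cases h : ab ∈ emptyBoxes x
    · rw [foolingDensity, Set.indicator_of_mem h, Set.indicator_of_mem h, mul_assoc]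
      congr 1
      rw [← Real.rpow_add_one' (boxVolume_nonneg hab) (by simpa using hpq.ne_zero),
        sub_add_cancel]
    · rw [foolingDensity, Set.indicator_of_notMem h, Set.indicator_of_notMem h, zero_mul]
  rw [hrule, sub_zero, hint, ← ENNReal.ofReal_mul' (by positivity)]
  refine ENNReal.ofReal_le_ofReal (le_trans ?_ (le_abs_self _))
  have hpow : K ^ (1 / p) = K ^ (-(1 / q)) * K := by
    rw [← Real.rpow_add_one hK0.ne']
    congr 1
    have := hpq.inv_add_inv_eq_one
    simp only [one_div]
    linarith
  rw [hpow, mul_left_comm]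
  exact mul_le_mul_of_nonneg_left (le_setIntegral_emptyBoxes hpq.nonneg x) (by positivity)

/-! ### From error bounds to bounds on `N`. -/

lemma ofReal_le_iInf_natCast {L : ℝ} {P : ℕ → Prop} (h : ∀ N, P N → L ≤ N) :
    ENNReal.ofReal L ≤ ((⨅ (N : ℕ) (_ : P N), (N : ℕ∞) : ℕ∞) : ℝ≥0∞) := by
  have h1 : ((⌈L⌉₊ : ℕ) : ℕ∞) ≤ ⨅ (N : ℕ) (_ : P N), (N : ℕ∞) :=
    le_iInf₂ fun N hN => Nat.cast_le.2 (Nat.ceil_le.2 (h N hN))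
  refine le_trans ?_ (ENat.toENNReal_le.2 h1)
  rw [ENat.toENNReal_coe]
  exact ENNReal.ofReal_le_of_le_toReal (by simpa using Nat.le_ceil L)

lemma one_lt_inv_one_sub_missedMass {p : ℝ} (hp : 0 ≤ p) : 1 < (1 - missedMass p)⁻¹ :=
  (one_lt_inv₀ (by linarith [missedMass_lt_one hp])).2 (by linarith [missedMass_pos p])

/-- Cancelling `E` gives `1 - N * ρ ^ d ≤ ε`, that is `N ≥ ρ⁻¹ ^ d * (1 - ε)`, which is slightly
stronger. -/
lemma le_natCast_of_ofReal_mul_le {ρ ε : ℝ} (hρ : 0 < ρ) (hε : 0 ≤ ε) {E : ℝ≥0∞}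
    (hE : E ≠ 0) (hE' : E ≠ ⊤)
    (h : ENNReal.ofReal (1 - N * ρ ^ d) * E ≤ ENNReal.ofReal ε * E) :
    ρ⁻¹ ^ d * (1 - 2 * ε) ≤ N := by
  rw [ENNReal.mul_le_mul_iff_left hE hE', ENNReal.ofReal_le_ofReal_iff hε] at h
  rw [inv_pow, inv_mul_le_iff₀ (pow_pos hρ d)]
  linarith

end ExtremeDiscrepancy

open ExtremeDiscrepancy

theorem mainTheorem3 (p q : ℝ) (hq : 1 < q) (hpq : 1 / p + 1 / q = 1) :
    ∃ C : ℝ, 1 < C ∧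
      (∀ (d : ℕ) (ε : ℝ), 1 ≤ d → 0 ≤ ε → ε < 1 / 2 →
        ENNReal.ofReal (C ^ d * (1 - 2 * ε)) ≤
          ((ExtremeDiscrepancy.inverseDiscrepancyNonneg p ε d : ℕ∞) : ℝ≥0∞)) ∧
      (∀ (d : ℕ) (ε : ℝ), 1 ≤ d → 0 ≤ ε → ε < 1 / 2 →
        ENNReal.ofReal (C ^ d * (1 - 2 * ε)) ≤
          ((ExtremeDiscrepancy.infoComplexityNonneg q ε d : ℕ∞) : ℝ≥0∞)) ∧
      ExtremeDiscrepancy.CurseOfDimensionality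
        (fun ε d => ExtremeDiscrepancy.infoComplexityNonneg q ε d) := by
  have hconj : p.HolderConjugate q :=
    (Real.holderConjugate_iff.2 ⟨hq, by simpa [add_comm] using hpq⟩).symm
  have hρ : 0 < 1 - missedMass p := by linarith [missedMass_lt_one hconj.nonneg]
  have hE : ∀ d, ENNReal.ofReal ((∫ ab, boxVolume ab ^ p ∂boxMeasure d) ^ (1 / p)) ≠ 0 :=
    fun d => by simpa using Real.rpow_pos_of_pos (integral_boxVolume_rpow_pos hconj.nonneg) _
  have hint : ∀ (d : ℕ) (ε : ℝ), 0 ≤ ε →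
      ENNReal.ofReal ((1 - missedMass p)⁻¹ ^ d * (1 - 2 * ε)) ≤
        ((infoComplexityNonneg q ε d : ℕ∞) : ℝ≥0∞) := by
    refine fun d ε hε => ofReal_le_iInf_natCast fun N hN => ?_
    refine le_natCast_of_ofReal_mul_le hρ hε (hE d) ENNReal.ofReal_ne_top ?_
    have hlow := le_iInf₂ fun P (_ : P ∈ nonnegRules N d) => le_worstCaseError hconj P.1 P.2
    exact hlow.trans (hN.trans (mul_le_mul_right (initialError_le hconj) _))
  have hC := one_lt_inv_one_sub_missedMass hconj.nonneg
  refine ⟨(1 - missedMass p)⁻¹, hC, fun d ε _ hε _ => ?_, fun d ε _ hε _ => hint d ε hε, ?_⟩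
  · refine ofReal_le_iInf_natCast fun N hN => ?_
    refine le_natCast_of_ofReal_mul_le hρ hε (hE d) ENNReal.ofReal_ne_top ?_
    rw [initialDiscrepancy_eq hconj.lt] at hN
    have hlow := le_iInf₂ fun P (_ : P ∈ nonnegRules N d) =>
      le_extremeDiscrepancy hconj.lt P.1 P.2
    exact hlow.trans hN
  -- For `ε ≤ 1 / 4` the factor `1 - 2 * ε` is at least `1 / 2`, and `1 + γ` is `C` itself.
  · refine ⟨1 / 2, by norm_num, (1 - missedMass p)⁻¹ - 1, by linarith, 1 / 4, by norm_num,
      fun ε hε hε' d _ => le_trans (ENNReal.ofReal_le_ofReal ?_) (hint d ε hε.le)⟩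
    rw [add_sub_cancel, mul_comm]
    have : 0 < (1 - missedMass p)⁻¹ ^ d := by positivity
    gcongr
    linarith
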